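/- Let $S$ be a nonempty set, $\Sigma$ an algebra of subsets of $S$, and $X$ a nonempty convex subset of a real vector space. Let $\mathcal F$ be the set of (simple) acts, i.e. of $\Sigma$-measurable functions $f:S\to X$ with finite range, with mixtures $\alpha f+(1-\alpha)g$ taken statewise; each $x\in X$ is identified with the constant act equal to $x$. Let $\triangle(S)$ be the set of finitely additive probabilities on $\Sigma$ with the weak* topology (setwise convergence on $\Sigma$). Let $\succsim$ be a binary relation on $\mathcal F$ with asymmetric part $\succ$ and symmetric part $\sim$. $\succsim$ is *MBA* if: (weak order) it is complete and transitive; (risk independence) for all $x,y,z\in X$ and $\alpha\in(0,1)$, $x\sim y$ implies $\alpha x+(1-\alpha)z\sim\alpha y+(1-\alpha)z$, and $x\succ y$ implies $\alpha x+(1-\alpha)z\succ\alpha y+(1-\alpha)z$; (Archimedean continuity) if $f,g,h\in\mathcal F$ and $f\succ g\succ h$, there are $\alpha,\beta\in(0,1)$ with $\alpha f+(1-\alpha)h\succ g\succ\beta f+(1-\beta)h$; (monotonicity) if $f(s)\succsim g(s)$ for all $s\in S$, then $f\succsim g$. It exhibits *decreasing absolute ambiguity aversion* if for all $f\in\mathcal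 F$, $x,y,z\in X$, $\alpha\in(0,1)$ with $y\succsim x$, $$\alpha f+(1-\alpha)x\succsim\alpha z+(1-\alpha)x\ \Longrightarrow\ \alpha f+(1-\alpha)y\succsim\alpha z+(1-\alpha)y .$$ The following are equivalent. (i) $\succsim$ is MBA and exhibits decreasing absolute ambiguity aversion. (ii) There exist an affine function $u:X\to\mathbb R$ and, for every $f\in\mathcal F$, a family $C_f$ of lower semicontinuous and convex functions $c:\triangle(S)\to(-\infty,\infty]$ such that all the maxima and minima below are attained and, with $$V(f)=\max_{c\in C_f}\min_{p\in\triangle(S)}\Big\{\int_S u(f)\,dp+c(p)\Big\}\in\mathbb R,$$ - $f\succsim g\iff V(f)\ge V(g)$ for all $f,g\in\mathcal F$; - $\max_{c\in C_x}\min_{p\in\triangle(S)}c(p)=0$ for all $x\in X$; - $C_g\subseteq C_f$ for all $f,g\in\mathcal F$ with $u(f)\ge u(g)$ pointwise; - $V$ is continuous as a function of the utility profile $u(f)$, i.e. for every $f\in\mathcal F$ and $\varepsilon>0$ there is $\delta>0$ such that $|V(g)-V(f)|<\varepsilon$ for all $g\in\mathcal F$ with $\sup_{s\in S}|u(g(s))-u(f(s))|\le\delta$.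 -/

import Mathlib

/-- An algebra of subsets ("events") of the state space `S`. -/
structure EventAlgebra (S : Type*) where
  /-- the events -/
  sets : Set (Set S)
  isSetAlgebra : MeasureTheory.IsSetAlgebra sets

/-- Simple functions: finitely many values, each level set an event. With `Y` the set of
consequences these are the (simple) acts; with `Y = ℝ` they are the elements of `B₀(Σ)`. -/
structure SimpleMap {S : Type*} (A : EventAlgebra S) (Y : Type*) where
  /-- the underlying function -/
  toFun : S → Y
  finite_range : (Set.range toFun).Finite
  preimage_mem : ∀ y, toFun ⁻¹' {y} ∈ A.sets

namespace SimpleMap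

variable {S : Type*} {A : EventAlgebra S} {Y Z W : Type*}

theorem preimage_set_mem (f : SimpleMap A Y) (B : Set Y) : f.toFun ⁻¹' B ∈ A.sets := by
  have h : f.toFun ⁻¹' B
      = ⋃ y ∈ (f.finite_range.inter_of_left B).toFinset, f.toFun ⁻¹' {y} := by
    ext s
    simp
  rw [h]
  exact A.isSetAlgebra.biUnion_mem _ fun y _ => f.preimage_mem y

/-- The constant simple function. -/
def const (A : EventAlgebra S) (y : Y) : SimpleMap A Y where
  toFun := fun _ => y
  finite_range := (Set.finite_singleton y).subset (by rintro _ ⟨_, rfl⟩; rfl)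
  preimage_mem := by
    intro z
    by_cases h : y = z
    · have : (fun _ : S => y) ⁻¹' {z} = Set.univ := by ext; simp [h]
      rw [this]; exact A.isSetAlgebra.univ_mem
    · have : (fun _ : S => y) ⁻¹' {z} = ∅ := by ext; simp [h]
      rw [this]; exact A.isSetAlgebra.empty_mem

/-- Composition of a function with a simple function. -/
def map (u : Y → Z) (f : SimpleMap A Y) : SimpleMap A Z where
  toFun := fun s => u (f.toFun s)
  finite_range := (f.finite_range.image u).subset (by
    rintro _ ⟨s, rfl⟩; exact ⟨f.toFun s, ⟨s, rfl⟩, rfl⟩)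
  preimage_mem := fun z => f.preimage_set_mem (u ⁻¹' {z})

/-- Statewise combination of two simple functions. -/
def map₂ (u : Y → Z → W) (f : SimpleMap A Y) (g : SimpleMap A Z) : SimpleMap A W where
  toFun := fun s => u (f.toFun s) (g.toFun s)
  finite_range := (f.finite_range.image2 u g.finite_range).subset (by
    rintro _ ⟨s, rfl⟩; exact ⟨_, ⟨s, rfl⟩, _, ⟨s, rfl⟩, rfl⟩)
  preimage_mem := by
    intro w
    have h : (fun s => u (f.toFun s) (g.toFun s)) ⁻¹' {w}
        = ⋃ y ∈ f.finite_range.toFinset,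
            (f.toFun ⁻¹' {y} ∩ g.toFun ⁻¹' {z | u y z = w}) := by
      ext s
      simp only [Set.mem_preimage, Set.mem_singleton_iff, Set.mem_iUnion, Set.mem_inter_iff,
        Set.mem_ofPred_eq, Set.Finite.mem_toFinset, Set.mem_range]
      constructor
      · intro hs; exact ⟨f.toFun s, ⟨s, rfl⟩, rfl, hs⟩
      · rintro ⟨y, -, rfl, hs⟩; exact hs
    rw [h]
    exact A.isSetAlgebra.biUnion_mem _ fun y _ =>
      A.isSetAlgebra.inter_mem (f.preimage_mem y) (g.preimage_set_mem _)

end SimpleMap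

/-- The set `Δ(S)` of finitely additive probabilities on the algebra of events, as a subset of the
space of real functions on the algebra. The product (setwise convergence) topology it inherits is
the weak* topology given by the duality with simple functions. -/
def FinAddProb {S : Type*} (A : EventAlgebra S) : Set ({B : Set S // B ∈ A.sets} → ℝ) :=
  {p | (∀ B, 0 ≤ p B) ∧ p ⟨Set.univ, A.isSetAlgebra.univ_mem⟩ = 1 ∧
    ∀ (B D : Set S) (hB : B ∈ A.sets) (hD : D ∈ A.sets), Disjoint B D →
      p ⟨B ∪ D, A.isSetAlgebra.union_mem hB hD⟩ = p ⟨B, hB⟩ + p ⟨D, hD⟩}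

/-- The integral of a real simple function with respect to a finitely additive probability. -/
noncomputable def simpleIntegral {S : Type*} {A : EventAlgebra S} (φ : SimpleMap A ℝ)
    (p : FinAddProb A) : ℝ :=
  ∑ r ∈ φ.finite_range.toFinset, r * p.1 ⟨φ.toFun ⁻¹' {r}, φ.preimage_mem r⟩

/-- The mixture `α x + (1 - α) y` of two consequences. -/
def mix {E : Type*} [AddCommGroup E] [Module ℝ E] {X : Set E} (hX : Convex ℝ X)
    (α : unitInterval) (x y : X) : X :=
  ⟨(α : ℝ) • (x : E) + (1 - (α : ℝ)) • (y : E),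
    hX x.2 y.2 α.2.1 (sub_nonneg.2 α.2.2) (by ring)⟩

/-- The statewise mixture `α f + (1 - α) g` of two acts. -/
def mixAct {S E : Type*} [AddCommGroup E] [Module ℝ E] {X : Set E} {A : EventAlgebra S}
    (hX : Convex ℝ X) (α : unitInterval) (f g : SimpleMap A X) : SimpleMap A X :=
  SimpleMap.map₂ (mix hX α) f g

/-- `u` is affine on the convex set of consequences. -/
def IsAffineUtility {E : Type*} [AddCommGroup E] [Module ℝ E] {X : Set E} (hX : Convex ℝ X)
    (u : X → ℝ) : Prop :=
  ∀ (α : unitInterval) (x y : X), u (mix hX α x y) = (α : ℝ) * u x + (1 - (α : ℝ)) * u y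

/-- The asymmetric part of a relation. -/
def StrictPref {F : Type*} (R : F → F → Prop) (f g : F) : Prop := R f g ∧ ¬ R g f

/-- The symmetric part of a relation. -/
def Indiff {F : Type*} (R : F → F → Prop) (f g : F) : Prop := R f g ∧ R g f

section Axioms

variable {S E : Type*} [AddCommGroup E] [Module ℝ E] {X : Set E} {A : EventAlgebra S}

/-- Completeness and transitivity. -/
def WeakOrder (R : SimpleMap A X → SimpleMap A X → Prop) : Prop :=
  (∀ f g, R f g ∨ R g f) ∧ ∀ f g h, R f g → R g h → R f h

/-- Independence for consequences, for indifference and for strict preference. -/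
def RiskIndependence (hX : Convex ℝ X) (R : SimpleMap A X → SimpleMap A X → Prop) : Prop :=
  ∀ (x y z : X) (α : unitInterval), 0 < α → α < 1 →
    (Indiff R (.const A x) (.const A y) →
      Indiff R (.const A (mix hX α x z)) (.const A (mix hX α y z))) ∧
    (StrictPref R (.const A x) (.const A y) →
      StrictPref R (.const A (mix hX α x z)) (.const A (mix hX α y z)))

/-- Archimedean continuity, with nondegenerate weights. -/
def ArchimedeanContinuity (hX : Convex ℝ X) (R : SimpleMap A X → SimpleMap A X → Prop) : Prop :=
  ∀ f g h, StrictPref R f g → StrictPref R g h →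
    ∃ α β : unitInterval, 0 < α ∧ α < 1 ∧ 0 < β ∧ β < 1 ∧
      StrictPref R (mixAct hX α f h) g ∧ StrictPref R g (mixAct hX β f h)

/-- Statewise monotonicity. -/
def MonotonePref (R : SimpleMap A X → SimpleMap A X → Prop) : Prop :=
  ∀ f g : SimpleMap A X, (∀ s, R (.const A (f.toFun s)) (.const A (g.toFun s))) → R f g

/-- MBA (monotone, Bernoulli, Archimedean) preferences. -/
structure IsMBA (hX : Convex ℝ X) (R : SimpleMap A X → SimpleMap A X → Prop) : Prop where
  weakOrder : WeakOrder R
  riskIndependence : RiskIndependence hX R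
  archimedean : ArchimedeanContinuity hX R
  monotone : MonotonePref R

/-- Decreasing absolute ambiguity aversion. -/
def DecreasingAbsoluteAmbiguityAversion (hX : Convex ℝ X)
    (R : SimpleMap A X → SimpleMap A X → Prop) : Prop :=
  ∀ (f : SimpleMap A X) (x y z : X) (α : unitInterval), 0 < α → α < 1 →
    R (.const A y) (.const A x) →
    R (mixAct hX α f (.const A x)) (mixAct hX α (.const A z) (.const A x)) →
    R (mixAct hX α f (.const A y)) (mixAct hX α (.const A z) (.const A y))

end Axioms

/-- `c : Δ(S) → (-∞, ∞]` is lower semicontinuous and convex. -/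
structure IsAmbiguityCost {S : Type*} {A : EventAlgebra S} (c : FinAddProb A → EReal) : Prop where
  ne_bot : ∀ p, c p ≠ ⊥
  lowerSemicontinuous : LowerSemicontinuous c
  convex : ∀ (p q r : FinAddProb A) (a b : ℝ), 0 < a → 0 < b → a + b = 1 →
    r.1 = a • p.1 + b • q.1 → c r ≤ (a : EReal) * c p + (b : EReal) * c q

/-- `v = max_{d ∈ D} min_p d p`, all the minima and the maximum being attained. -/
def IsMaxMin {P : Type*} (D : Set (P → EReal)) (v : EReal) : Prop :=
  (∀ d ∈ D, ∃ m, IsLeast (Set.range d) m) ∧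
    IsGreatest {m | ∃ d ∈ D, IsLeast (Set.range d) m} v

/-- `V`, as a function of the utility profile `u ∘ f` of the act `f`, is continuous for the
supremum norm on `B₀(Σ, u(X))`. -/
def SupNormContinuous {S Y : Type*} {A : EventAlgebra S} (u : Y → ℝ) (V : SimpleMap A Y → ℝ) :
    Prop :=
  ∀ f : SimpleMap A Y, ∀ ε > 0, ∃ δ > 0, ∀ g : SimpleMap A Y,
    (∀ s, |u (g.toFun s) - u (f.toFun s)| ≤ δ) → |V g - V f| < ε

/-- The act-dependent variational representation of `R`: an affine utility `u`, families `C f` of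
ambiguity costs, and the evaluation `V f = max_{c ∈ C f} min_p {∫ u(f) dp + c(p)}`. -/
structure IsActDependentVariational {S E : Type*} [AddCommGroup E] [Module ℝ E] {X : Set E}
    {A : EventAlgebra S} (hX : Convex ℝ X) (R : SimpleMap A X → SimpleMap A X → Prop)
    (u : X → ℝ) (C : SimpleMap A X → Set (FinAddProb A → EReal)) (V : SimpleMap A X → ℝ) :
    Prop where
  affine : IsAffineUtility hX u
  cost : ∀ f, ∀ c ∈ C f, IsAmbiguityCost c
  value : ∀ f, IsMaxMin
    ((fun c p => ((simpleIntegral (f.map u) p : ℝ) : EReal) + c p) '' C f) (V f : EReal)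
  represents : ∀ f g, R f g ↔ V g ≤ V f
  normalized : ∀ x : X, IsMaxMin (C (.const A x)) 0
  enlarging : ∀ f g : SimpleMap A X, (∀ s, u (g.toFun s) ≤ u (f.toFun s)) → C g ⊆ C f
  continuous : SupNormContinuous u V

/-! On constant acts the MBA axioms are those of expected utility, so a mixture space theorem
(`IsBernoulli.exists_affine`) yields an affine `u`. Archimedean continuity gives every act a
certainty equivalent (`IsMBA.exists_indiff_const`), whose utility is taken as V(f).

Everything then turns on one inequality: if m ≥ 0 and u(g) + m ≤ u(f) statewise, then V(g) + m ≤
V(f). Decreasing absolute ambiguity aversion implies it (`IsMonotoneEvaluation.add_le`), since g can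
be written, in utility, as a mixture with its worst consequence x; replacing x by a suitable better
y raises the utility of g, and that of its constant equivalent, by exactly m.

Given the inequality, each g with u(g) ≤ u(f) supplies the cost c_g(p) = V(g) - ∫u(g) dp. The
minimum of ∫(u(f) - u(g)) dp is reached at a point mass, so c_g contributes V(g) + min (u(f) - u(g))
≤ V(f), with equality for g = f. Enlarging u(f) only adds admissible g.

Conversely, a cost optimal at g is still available at any f with u(f) ≥ u(g), which returns the
inequality (`IsActDependentVariational.add_le`), hence monotonicity and decreasing aversion.
Sup-norm continuity of V corresponds to the Archimedean axiom in both directions. -/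

/-! ### Expected utility on a convex set, by extension of positive functionals. -/

section ExpectedUtility

variable {E : Type*} [AddCommGroup E] [Module ℝ E] {X : Set E} {hX : Convex ℝ X}

/-- The hypotheses of the mixture space theorem for a relation on a convex set. -/
structure IsBernoulli (hX : Convex ℝ X) (P : X → X → Prop) : Prop where
  total : ∀ x y, P x y ∨ P y x
  trans : ∀ x y z, P x y → P y z → P x z
  indep_indiff : ∀ (x y z : X) (α : unitInterval), 0 < α → α < 1 → Indiff P x y →
    Indiff P (mix hX α x z) (mix hX α y z)
  indep_strict : ∀ (x y z : X) (α : unitInterval), 0 < α → α < 1 → StrictPref P x y →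
    StrictPref P (mix hX α x z) (mix hX α y z)
  archimedean : ∀ x y z, StrictPref P x y → StrictPref P y z →
    ∃ α β : unitInterval, 0 < α ∧ α < 1 ∧ 0 < β ∧ β < 1 ∧
      StrictPref P (mix hX α x z) y ∧ StrictPref P y (mix hX β x z)

/-- A weight strictly between `0` and `1`, as an element of the unit interval. -/
def openWeight (a : ℝ) (h0 : 0 < a) (h1 : a < 1) : unitInterval := ⟨a, h0.le, h1.le⟩

theorem openWeight_pos (a : ℝ) (h0 : 0 < a) (h1 : a < 1) : 0 < openWeight a h0 h1 := h0

theorem openWeight_lt_one (a : ℝ) (h0 : 0 < a) (h1 : a < 1) : openWeight a h0 h1 < 1 := h1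

theorem coe_mix_openWeight (a : ℝ) (h0 : 0 < a) (h1 : a < 1) (x y : X) :
    (mix hX (openWeight a h0 h1) x y : E) = a • (x : E) + (1 - a) • (y : E) := rfl

theorem coe_mix (α : unitInterval) (x y : X) :
    (mix hX α x y : E) = (α : ℝ) • (x : E) + (1 - (α : ℝ)) • (y : E) := rfl

namespace IsBernoulli

variable {P : X → X → Prop}

theorem weak_indep (h : IsBernoulli hX P) {x y : X} (z : X) {α : unitInterval}
    (h0 : 0 < α) (h1 : α < 1) (hxy : P x y) : P (mix hX α x z) (mix hX α y z) := by
  by_cases hyx : P y x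
  · exact (h.indep_indiff x y z α h0 h1 ⟨hxy, hyx⟩).1
  · exact (h.indep_strict x y z α h0 h1 ⟨hxy, hyx⟩).1

/-- The ranking of `x` and `y` depends only on the ray spanned by `x - y`. -/
theorem of_smul_sub_eq (h : IsBernoulli hX P) {x y x' y' : X} {t s : ℝ} (ht : 0 < t) (hs : 0 < s)
    (he : t • ((x : E) - y) = s • ((x' : E) - y')) (hxy : P x y) : P x' y' := by
  by_contra hn
  have hst : StrictPref P y' x' := ⟨(h.total x' y').resolve_left hn, hn⟩
  have hts : 0 < t + s := by positivity
  have a0 : 0 < s / (t + s) := by positivity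
  have a1 : s / (t + s) < 1 := by rw [div_lt_one hts]; linarith
  have b0 : 0 < t / (t + s) := by positivity
  have b1 : t / (t + s) < 1 := by rw [div_lt_one hts]; linarith
  have hab : 1 - s / (t + s) = t / (t + s) := by field_simp; ring
  have hba : 1 - t / (t + s) = s / (t + s) := by field_simp; ring
  have k1 := h.indep_strict y' x' x _ (openWeight_pos _ a0 a1) (openWeight_lt_one _ a0 a1) hst
  have k2 := h.weak_indep x' (openWeight_pos _ b0 b1) (openWeight_lt_one _ b0 b1) hxy
  -- Since t x + s y' = t y + s x', the two mixtures compared in `k2` are those of `k1` in the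
  -- opposite order.
  have e1 : mix hX (openWeight _ b0 b1) x x' = mix hX (openWeight _ a0 a1) x' x := by
    ext
    rw [coe_mix_openWeight, coe_mix_openWeight, hab, hba, add_comm]
  have e2 : mix hX (openWeight _ b0 b1) y x' = mix hX (openWeight _ a0 a1) y' x := by
    ext
    rw [coe_mix_openWeight, coe_mix_openWeight, hab, hba]
    have : t • (y : E) + s • (x' : E) = s • (y' : E) + t • (x : E) := by
      rw [smul_sub, smul_sub, sub_eq_sub_iff_add_eq_add] at he
      rw [add_comm, ← he, add_comm]
    have h2 := congrArg (fun v => (t + s)⁻¹ • v) this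
    simpa only [smul_add, smul_smul, div_eq_inv_mul] using h2
  rw [e1, e2] at k2
  exact k1.2 k2

/-- Source of additivity both for the space of directions and for the cone of improvements. -/
theorem combine {x y x' y' : X} {t s : ℝ} (ht : 0 < t) (hs : 0 < s)
    (a0 : 0 < t / (t + s)) (a1 : t / (t + s) < 1) :
    t • ((x : E) - y) + s • ((x' : E) - y') =
      (t + s) • ((mix hX (openWeight _ a0 a1) x x' : E) - mix hX (openWeight _ a0 a1) y y') := by
  rw [coe_mix_openWeight, coe_mix_openWeight]
  have hts : t + s ≠ 0 := by positivity
  match_scalars <;> field_simp <;> ring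

theorem mix_mix (h : IsBernoulli hX P) {x y x' y' : X} {α : unitInterval} (h0 : 0 < α)
    (h1 : α < 1) (hxy : P x y) (hxy' : P x' y') : P (mix hX α x x') (mix hX α y y') := by
  refine h.trans _ _ _ (h.weak_indep x' h0 h1 hxy) ?_
  have k := h.weak_indep (α := unitInterval.symm α) y
    (by simpa [← unitInterval.coe_pos] using h1)
    (by simpa [← unitInterval.coe_lt_one] using h0) hxy'
  have e : ∀ v w : X, mix hX (unitInterval.symm α) v w = mix hX α w v := by
    intro v w
    ext
    rw [coe_mix, coe_mix, unitInterval.coe_symm_eq, add_comm]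
    simp
  rwa [e, e] at k

/-- The space of directions of a convex set. -/
def directions (hX : Convex ℝ X) (hne : X.Nonempty) : Submodule ℝ E where
  carrier := {d | ∃ t : ℝ, 0 < t ∧ ∃ x y : X, d = t • ((x : E) - y)}
  zero_mem' := by
    obtain ⟨x, hx⟩ := hne
    exact ⟨1, one_pos, ⟨x, hx⟩, ⟨x, hx⟩, by simp⟩
  add_mem' := by
    rintro _ _ ⟨t, ht, x, y, rfl⟩ ⟨s, hs, x', y', rfl⟩
    have hts : 0 < t + s := by positivity
    have a0 : 0 < t / (t + s) := by positivity
    have a1 : t / (t + s) < 1 := by rw [div_lt_one hts]; linarith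
    exact ⟨t + s, hts, _, _, combine (hX := hX) ht hs a0 a1⟩
  smul_mem' := by
    rintro r _ ⟨t, ht, x, y, rfl⟩
    rcases lt_trichotomy r 0 with hr | rfl | hr
    · refine ⟨-r * t, mul_pos (neg_pos.2 hr) ht, y, x, ?_⟩
      match_scalars <;> ring
    · exact ⟨1, one_pos, x, x, by simp⟩
    · exact ⟨r * t, mul_pos hr ht, x, y, by rw [smul_smul]⟩

theorem sub_mem_directions (hne : X.Nonempty) (x y : X) :
    (x : E) - y ∈ directions hX hne := ⟨1, one_pos, x, y, by simp⟩

/-- The cone of directions of improvement. -/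
def improvements (h : IsBernoulli hX P) (hne : X.Nonempty) :
    PointedCone ℝ (directions hX hne) where
  zero_mem' := by
    obtain ⟨x, hx⟩ := hne
    exact ⟨1, one_pos, ⟨x, hx⟩, ⟨x, hx⟩, (h.total _ _).elim id id, by simp⟩
  carrier := {d | ∃ t : ℝ, 0 < t ∧ ∃ x y : X, P x y ∧ (d : E) = t • ((x : E) - y)}
  smul_mem' := by
    rintro ⟨r, hr⟩ d ⟨t, ht, x, y, hxy, hd⟩
    rcases hr.eq_or_lt with rfl | hr
    · exact ⟨1, one_pos, x, x, (h.total _ _).elim id id, by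
        rw [Nonneg.mk_smul]
        simp⟩
    · exact ⟨r * t, mul_pos hr ht, x, y, hxy, by
        rw [Nonneg.mk_smul, Submodule.coe_smul, hd, smul_smul]⟩
  add_mem' := by
    rintro d d' ⟨t, ht, x, y, hxy, hd⟩ ⟨s, hs, x', y', hxy', hd'⟩
    have hts : 0 < t + s := by positivity
    have a0 : 0 < t / (t + s) := by positivity
    have a1 : t / (t + s) < 1 := by rw [div_lt_one hts]; linarith
    refine ⟨t + s, hts, _, _, h.mix_mix (openWeight_pos _ a0 a1) (openWeight_lt_one _ a0 a1)
      hxy hxy', ?_⟩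
    rw [Submodule.coe_add, hd, hd', combine (hX := hX) ht hs a0 a1]

/-- The two strict preferences need not be linked, so they are chained by halving: ½a + ½z ≻ ½b + ½z
≻ ½b + ½x. The Archimedean axiom applies to this chain, and the factor 2 undoes the halving. In
terms of directions, a small enough multiple of a - b can be outweighed, and a large enough one
outweighs x - z. -/
theorem exists_weights (h : IsBernoulli hX P) {a b z x : X} (hab : StrictPref P a b)
    (hzx : StrictPref P z x) :
    ∃ α β : ℝ, 0 < α ∧ α < 1 ∧ 0 < β ∧ β < 1 ∧
      (∃ v w : X, P v w ∧ α • ((a : E) - b) + (1 - α) • ((x : E) - z) = (2 : ℝ) • ((v : E) - w)) ∧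
      ∃ v w : X, P v w ∧
        β • ((b : E) - a) + (1 - β) • ((z : E) - x) = (2 : ℝ) • ((v : E) - w) := by
  have o0 : (0 : ℝ) < 1 / 2 := by norm_num
  have o1 : (1 / 2 : ℝ) < 1 := by norm_num
  have k1 := h.indep_strict a b z _ (openWeight_pos _ o0 o1) (openWeight_lt_one _ o0 o1) hab
  have k2 := h.indep_strict z x b _ (openWeight_pos _ o0 o1) (openWeight_lt_one _ o0 o1) hzx
  have e : mix hX (openWeight _ o0 o1) z b = mix hX (openWeight _ o0 o1) b z := by
    ext
    rw [coe_mix_openWeight, coe_mix_openWeight]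
    module
  rw [e] at k2
  obtain ⟨α, β, α0, α1, β0, β1, hα, hβ⟩ := h.archimedean _ _ _ k1 k2
  refine ⟨α, β, α0, α1, β0, β1, ⟨_, _, hα.1, ?_⟩, ⟨_, _, hβ.1, ?_⟩⟩
  · rw [coe_mix, coe_mix_openWeight, coe_mix_openWeight, coe_mix_openWeight]
    module
  · rw [coe_mix_openWeight, coe_mix, coe_mix_openWeight, coe_mix_openWeight]
    module

/-- The mixture space theorem. -/
theorem exists_affine (h : IsBernoulli hX P) (hne : X.Nonempty) :
    ∃ u : X → ℝ, IsAffineUtility hX u ∧ ∀ x y, P x y ↔ u y ≤ u x := by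
  by_cases hall : ∀ x y, P x y
  · exact ⟨fun _ => 0, fun α x y => by simp, fun x y => by simp [hall x y]⟩
  push Not at hall
  obtain ⟨b, a, hba⟩ := hall
  have hab : StrictPref P a b := ⟨(h.total a b).resolve_right hba, hba⟩
  let D := directions hX hne
  let e : D := ⟨(a : E) - b, sub_mem_directions hne a b⟩
  have hne0 : e ≠ 0 := by
    intro he
    have : (a : E) - b = 0 := congrArg Subtype.val he
    have hab' : a = b := Subtype.ext (sub_eq_zero.1 this)
    exact hba (by rw [hab']; exact (h.total b b).elim id id)
  let f : D →ₗ.[ℝ] ℝ := LinearPMap.mkSpanSingleton e (1 : ℝ) hne0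
  have hf : ∀ r : ℝ, ∀ hr, f ⟨r • e, hr⟩ = r := by
    intro r hr
    have := LinearPMap.mkSpanSingleton'_apply e (1 : ℝ)
      (fun c hc => by simpa [hne0] using hc) r hr
    simpa [f] using this
  have hdom : ∀ r : ℝ, r • e ∈ f.domain := fun r =>
    Submodule.mem_span_singleton.2 ⟨r, rfl⟩
  -- Riesz extension of r • e ↦ r: nonnegativity on the line holds because -e is not an improvement,
  -- and every direction becomes an improvement after adding a multiple of e.
  have hext : ∃ g : D →ₗ[ℝ] ℝ, (∀ x : f.domain, g x = f x) ∧ ∀ x ∈ h.improvements hne, 0 ≤ g x := by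
    refine riesz_extension _ f ?_ ?_
    · rintro ⟨x, hx⟩ hxs
      obtain ⟨r, rfl⟩ := Submodule.mem_span_singleton.1 hx
      rw [hf]
      by_contra hr
      push Not at hr
      obtain ⟨t, ht, x, y, hxy, he⟩ := hxs
      have k := h.of_smul_sub_eq (x' := b) (y' := a) ht (neg_pos.2 hr) (by
        rw [← he]
        simp only [e, Submodule.coe_smul]
        module) hxy
      exact hba k
    · rintro ⟨_, t, ht, x, z, rfl⟩
      by_cases hxz : P x z
      · exact ⟨⟨(0 : ℝ) • e, hdom 0⟩, t, ht, x, z, hxz, by simp⟩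
      · have hzx : StrictPref P z x := ⟨(h.total x z).resolve_left hxz, hxz⟩
        obtain ⟨α, β, α0, α1, -, -, ⟨v, w, hvw, he⟩, -⟩ := h.exists_weights hab hzx
        have h1 : 0 < 1 - α := by linarith
        refine ⟨⟨(t / (1 - α) * α) • e, hdom _⟩, t / (1 - α) * 2, by positivity, v, w, hvw, ?_⟩
        rw [mul_smul _ (2 : ℝ), ← he]
        simp only [e, Submodule.coe_add, Submodule.coe_smul]
        match_scalars <;> field_simp
  obtain ⟨g, hg, hgs⟩ := hext
  have hge : g e = 1 := by
    have := hg ⟨(1 : ℝ) • e, hdom 1⟩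
    rw [hf] at this
    simpa using this
  let d : X → X → D := fun x y => ⟨(x : E) - y, sub_mem_directions hne x y⟩
  have hpos : ∀ x y, P x y → 0 ≤ g (d x y) := fun x y hxy =>
    hgs _ ⟨1, one_pos, x, y, hxy, by simp [d]⟩
  have hspos : ∀ x y, StrictPref P x y → 0 < g (d x y) := by
    intro x y hxy
    obtain ⟨α, β, -, -, β0, β1, -, v, w, hvw, he⟩ := h.exists_weights hab hxy
    -- Strictness: x - y remains an improvement after a positive multiple of e is taken away, so (1
    -- - β) g(x - y) ≥ β > 0.
    have k := hgs (-(β • e) + (1 - β) • d x y) ⟨2, two_pos, v, w, hvw, by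
      rw [← he]
      simp only [e, d, Submodule.coe_add, Submodule.coe_neg, Submodule.coe_smul]
      module⟩
    rw [map_add, map_neg, map_smul, map_smul, hge, smul_eq_mul, smul_eq_mul] at k
    by_contra hn
    nlinarith
  refine ⟨fun x => g (d x b), ?_, ?_⟩
  · intro α x y
    rw [← smul_eq_mul, ← smul_eq_mul, ← map_smul, ← map_smul, ← map_add]
    refine congrArg g (Subtype.ext ?_)
    simp only [d, Submodule.coe_add, Submodule.coe_smul, coe_mix]
    module
  · intro x y
    have hsub : d x b - d y b = d x y := by
      ext
      simp [d]
    have hsub' : g (d x b) - g (d y b) = g (d x y) := by rw [← map_sub, hsub]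
    have hsub2 : d y b - d x b = d y x := by
      ext
      simp [d]
    have hsub2' : g (d y b) - g (d x b) = g (d y x) := by rw [← map_sub, hsub2]
    constructor
    · intro hxy
      have := hpos x y hxy
      linarith
    · intro hle
      by_contra hn
      have := hspos y x ⟨(h.total x y).resolve_left hn, hn⟩
      linarith

end IsBernoulli

end ExpectedUtility

/-! ### Integration of simple functions against finitely additive probabilities. -/

section Integral

variable {S : Type*} {A : EventAlgebra S}

namespace FinAddProb

theorem empty (p : FinAddProb A) : p.1 ⟨∅, A.isSetAlgebra.empty_mem⟩ = 0 := by
  have h := p.2.2.2 ∅ ∅ A.isSetAlgebra.empty_mem A.isSetAlgebra.empty_mem (by simp)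
  simp only [Set.union_empty] at h
  linarith

theorem congr_set (p : FinAddProb A) {B D : Set S} (hB : B ∈ A.sets) (hD : D ∈ A.sets)
    (h : B = D) : p.1 ⟨B, hB⟩ = p.1 ⟨D, hD⟩ := by
  subst h; rfl

theorem biUnion {ι : Type*} (p : FinAddProb A) (F : Finset ι) (B : ι → Set S)
    (hB : ∀ i, B i ∈ A.sets) (hd : Pairwise (Function.onFun Disjoint B)) :
    p.1 ⟨⋃ i ∈ F, B i, A.isSetAlgebra.biUnion_mem F fun i _ => hB i⟩ =
      ∑ i ∈ F, p.1 ⟨B i, hB i⟩ := by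
  classical
  induction F using Finset.induction_on with
  | empty => simpa using FinAddProb.empty p
  | insert i F hi ih =>
    rw [Finset.sum_insert hi, ← ih, ← p.2.2.2 (B i) (⋃ j ∈ F, B j) (hB i)]
    · exact FinAddProb.congr_set p _ _ (by simp)
    · rw [Set.disjoint_iUnion₂_right]
      intro j hj
      exact hd fun hij => hi (hij ▸ hj)

/-- The point mass at a state. -/
noncomputable def dirac (A : EventAlgebra S) (s : S) : FinAddProb A :=
  ⟨fun B => Set.indicator B.1 (fun _ => 1) s, by
    refine ⟨fun B => Set.indicator_nonneg (by simp) _, by simp, ?_⟩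
    intro B D hB hD hd
    exact congrFun (Set.indicator_union_of_disjoint hd (fun _ => (1 : ℝ))) s⟩

end FinAddProb

theorem disjoint_levels {Y : Type*} (χ : SimpleMap A Y) :
    Pairwise (Function.onFun Disjoint fun y => χ.toFun ⁻¹' {y}) := by
  intro y z hyz
  exact Disjoint.preimage _ (by simpa using hyz)

theorem sum_levels {Y : Type*} (χ : SimpleMap A Y) (p : FinAddProb A) :
    ∑ y ∈ χ.finite_range.toFinset, p.1 ⟨χ.toFun ⁻¹' {y}, χ.preimage_mem y⟩ = 1 := by
  rw [← FinAddProb.biUnion p _ _ χ.preimage_mem (disjoint_levels χ), ← p.2.2.1]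
  exact FinAddProb.congr_set p _ _ (by ext s; simp)

/-- Change of variables for the integral of a simple function. -/
theorem simpleIntegral_map {Y : Type*} (χ : SimpleMap A Y) (h : Y → ℝ) (p : FinAddProb A) :
    simpleIntegral (χ.map h) p =
      ∑ y ∈ χ.finite_range.toFinset, h y * p.1 ⟨χ.toFun ⁻¹' {y}, χ.preimage_mem y⟩ := by
  classical
  rw [simpleIntegral, ← Finset.sum_fiberwise_of_maps_to
    (s := χ.finite_range.toFinset) (t := (χ.map h).finite_range.toFinset) (g := h)]
  · refine Finset.sum_congr rfl fun r _ => ?_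
    have e : p.1 ⟨(χ.map h).toFun ⁻¹' {r}, (χ.map h).preimage_mem r⟩ =
        ∑ y ∈ χ.finite_range.toFinset with h y = r,
          p.1 ⟨χ.toFun ⁻¹' {y}, χ.preimage_mem y⟩ := by
      rw [← FinAddProb.biUnion p _ _ χ.preimage_mem (disjoint_levels χ)]
      refine FinAddProb.congr_set p _ _ ?_
      ext s
      simp [SimpleMap.map]
    rw [e, Finset.mul_sum]
    refine Finset.sum_congr rfl fun y hy => ?_
    rw [(Finset.mem_filter.1 hy).2]
  · intro y hy
    obtain ⟨s, rfl⟩ := (Set.Finite.mem_toFinset _).1 hy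
    exact (Set.Finite.mem_toFinset _).2 ⟨s, rfl⟩

/-- Both integrals are computed on the partition generated by the pair (φ, ψ), where the comparison
is termwise. -/
theorem add_simpleIntegral_le {φ ψ : SimpleMap A ℝ} {m : ℝ}
    (h : ∀ s, ψ.toFun s + m ≤ φ.toFun s) (p : FinAddProb A) :
    simpleIntegral ψ p + m ≤ simpleIntegral φ p := by
  let χ : SimpleMap A (ℝ × ℝ) := SimpleMap.map₂ Prod.mk φ ψ
  have e1 : simpleIntegral φ p = simpleIntegral (χ.map Prod.fst) p := rfl
  have e2 : simpleIntegral ψ p = simpleIntegral (χ.map Prod.snd) p := rfl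
  rw [e1, e2, simpleIntegral_map, simpleIntegral_map]
  have hm : m = ∑ y ∈ χ.finite_range.toFinset,
      m * p.1 ⟨χ.toFun ⁻¹' {y}, χ.preimage_mem y⟩ := by
    rw [← Finset.mul_sum, sum_levels, mul_one]
  conv_lhs => rw [hm]
  rw [← Finset.sum_add_distrib]
  refine Finset.sum_le_sum fun y hy => ?_
  obtain ⟨s, rfl⟩ := (Set.Finite.mem_toFinset _).1 hy
  rw [← add_mul]
  exact mul_le_mul_of_nonneg_right (h s) (p.2.1 _)

theorem simpleIntegral_eq_of_const {φ : SimpleMap A ℝ} {k : ℝ} (h : ∀ s, φ.toFun s = k)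
    (p : FinAddProb A) : simpleIntegral φ p = k := by
  have e : simpleIntegral φ p = ∑ r ∈ φ.finite_range.toFinset,
      k * p.1 ⟨φ.toFun ⁻¹' {r}, φ.preimage_mem r⟩ := by
    refine Finset.sum_congr rfl fun r hr => ?_
    obtain ⟨s, rfl⟩ := (Set.Finite.mem_toFinset _).1 hr
    rw [h s]
  rw [e, ← Finset.mul_sum, sum_levels, mul_one]

theorem simpleIntegral_dirac (φ : SimpleMap A ℝ) (s : S) :
    simpleIntegral φ (FinAddProb.dirac A s) = φ.toFun s := by
  classical
  rw [simpleIntegral, Finset.sum_eq_single (φ.toFun s)]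
  · simp [FinAddProb.dirac]
  · intro r _ hr
    simp [FinAddProb.dirac, hr.symm]
  · intro hn
    exact absurd (((Set.Finite.mem_toFinset _).2 (Set.mem_range_self s))) hn

theorem continuous_simpleIntegral (φ : SimpleMap A ℝ) :
    Continuous fun p : FinAddProb A => simpleIntegral φ p := by
  unfold simpleIntegral
  refine continuous_finsetSum _ fun r _ => ?_
  exact continuous_const.mul ((continuous_apply _).comp continuous_subtype_val)

theorem simpleIntegral_convexCombination (φ : SimpleMap A ℝ) {p q r : FinAddProb A} {a b : ℝ}
    (h : r.1 = a • p.1 + b • q.1) :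
    simpleIntegral φ r = a * simpleIntegral φ p + b * simpleIntegral φ q := by
  unfold simpleIntegral
  rw [Finset.mul_sum, Finset.mul_sum, ← Finset.sum_add_distrib]
  refine Finset.sum_congr rfl fun y _ => ?_
  rw [h]
  simp only [Pi.add_apply, Pi.smul_apply, smul_eq_mul]
  ring

theorem SimpleMap.exists_isMinOn [Nonempty S] {Y : Type*} (f : SimpleMap A Y) (h : Y → ℝ) :
    ∃ s₀, ∀ s, h (f.toFun s₀) ≤ h (f.toFun s) := by
  obtain ⟨_, ⟨s₀, rfl⟩, hs⟩ := f.finite_range.exists_minimalFor h _ (Set.range_nonempty _)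
  exact ⟨s₀, fun s => (le_total _ _).elim id fun hle => hs ⟨s, rfl⟩ hle⟩

/-- A difference of integrals is minimized at a point mass. -/
theorem exists_isLeast_simpleIntegral_sub [Nonempty S] (φ ψ : SimpleMap A ℝ) (v : ℝ) :
    ∃ m, (∃ s, φ.toFun s = ψ.toFun s + m) ∧ (∀ s, ψ.toFun s + m ≤ φ.toFun s) ∧
      IsLeast (Set.range fun p : FinAddProb A =>
        ((simpleIntegral φ p + (v - simpleIntegral ψ p) : ℝ) : EReal)) ((v + m : ℝ) : EReal) := by
  obtain ⟨s₀, hs⟩ := (SimpleMap.map₂ Prod.mk φ ψ).exists_isMinOn fun y => y.1 - y.2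
  simp only [SimpleMap.map₂] at hs
  have hm : ∀ s, ψ.toFun s + (φ.toFun s₀ - ψ.toFun s₀) ≤ φ.toFun s := fun s => by
    have := hs s
    linarith
  refine ⟨φ.toFun s₀ - ψ.toFun s₀, ⟨s₀, by ring⟩, hm, ⟨FinAddProb.dirac A s₀, ?_⟩, ?_⟩
  · simp only [simpleIntegral_dirac]
    congr 1
    ring
  · rintro _ ⟨p, rfl⟩
    have := add_simpleIntegral_le hm p
    exact EReal.coe_le_coe_iff.2 (by linarith)

end Integral

theorem SimpleMap.exists_weight_mul_le {S Y : Type*} [Nonempty S] {A : EventAlgebra S} (u : Y → ℝ)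
    (f g : SimpleMap A Y) {δ : ℝ}
    (hδ : 0 < δ) : ∃ t : ℝ, 0 < t ∧ t < 1 ∧
      ∀ s, t * |u (f.toFun s) - u (g.toFun s)| ≤ δ := by
  obtain ⟨s₀, hs⟩ := (SimpleMap.map₂ Prod.mk f g).exists_isMinOn fun y => -|u y.1 - u y.2|
  simp only [SimpleMap.map₂, neg_le_neg_iff] at hs
  set M := |u (f.toFun s₀) - u (g.toFun s₀)| with hM
  have hM0 : 0 ≤ M := abs_nonneg _
  -- The bound 1/2 keeps the weight below 1; M + 1 avoids dividing by zero.
  refine ⟨min (1 / 2) (δ / (M + 1)), by positivity, ?_, fun s => ?_⟩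
  · exact (min_le_left _ _).trans_lt (by norm_num)
  · calc min (1 / 2) (δ / (M + 1)) * |u (f.toFun s) - u (g.toFun s)|
        ≤ δ / (M + 1) * (M + 1) :=
          mul_le_mul (min_le_right _ _) ((hs s).trans (by linarith)) (abs_nonneg _) (by positivity)
      _ = δ := by field_simp

section Mixtures

variable {S E : Type*} [AddCommGroup E] [Module ℝ E] {X : Set E} {A : EventAlgebra S}
  {hX : Convex ℝ X}

theorem IsAffineUtility.mixAct {u : X → ℝ} (hu : IsAffineUtility hX u) (α : unitInterval)
    (f g : SimpleMap A X) (s : S) :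
    u ((mixAct hX α f g).toFun s) = (α : ℝ) * u (f.toFun s) + (1 - (α : ℝ)) * u (g.toFun s) :=
  hu α _ _

theorem IsAffineUtility.mixAct_const {u : X → ℝ} (hu : IsAffineUtility hX u) (α : unitInterval)
    (f : SimpleMap A X) (x : X) (s : S) :
    u ((_root_.mixAct hX α f (.const A x)).toFun s) =
      (α : ℝ) * u (f.toFun s) + (1 - (α : ℝ)) * u x :=
  hu α _ _

end Mixtures

/-! ### From the representation to the axioms. -/

namespace IsActDependentVariational

variable {S E : Type*} [AddCommGroup E] [Module ℝ E] {X : Set E} {A : EventAlgebra S}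
  {hX : Convex ℝ X} {R : SimpleMap A X → SimpleMap A X → Prop} {u : X → ℝ}
  {C : SimpleMap A X → Set (FinAddProb A → EReal)} {V : SimpleMap A X → ℝ}

/-- A cost optimal at g belongs to the family of f. At a p minimizing for f, the integral exceeds
that of u(g) by at least m. -/
theorem add_le (h : IsActDependentVariational hX R u C V) {f g : SimpleMap A X} {m : ℝ}
    (hm : 0 ≤ m) (hfg : ∀ s, u (g.toFun s) + m ≤ u (f.toFun s)) : V g + m ≤ V f := by
  obtain ⟨_, ⟨c, hc, rfl⟩, hleast⟩ := (h.value g).2.1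
  have hcf : c ∈ C f := h.enlarging f g (fun s => by linarith [hfg s]) hc
  obtain ⟨m', hm'⟩ := (h.value f).1 _ ⟨c, hcf, rfl⟩
  have hle := (h.value f).2.2 ⟨_, ⟨c, hcf, rfl⟩, hm'⟩
  obtain ⟨p, rfl⟩ := hm'.1
  have k1 := hleast.2 ⟨p, rfl⟩
  have k2 : simpleIntegral (g.map u) p + m ≤ simpleIntegral (f.map u) p :=
    add_simpleIntegral_le (φ := f.map u) (ψ := g.map u) hfg p
  have k3 : ((V g + m : ℝ) : EReal) ≤ (V f : EReal) := by
    refine le_trans ?_ hle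
    calc ((V g + m : ℝ) : EReal) = (V g : EReal) + m := EReal.coe_add _ _
      _ ≤ ((simpleIntegral (g.map u) p : ℝ) : EReal) + c p + m := add_le_add_left k1 _
      _ = ((simpleIntegral (g.map u) p + m : ℝ) : EReal) + c p := by
        rw [EReal.coe_add, add_right_comm]
      _ ≤ ((simpleIntegral (f.map u) p : ℝ) : EReal) + c p :=
        add_le_add_left (EReal.coe_le_coe_iff.2 k2) _
  exact EReal.coe_le_coe_iff.1 k3

theorem mono (h : IsActDependentVariational hX R u C V) {f g : SimpleMap A X}
    (hfg : ∀ s, u (g.toFun s) ≤ u (f.toFun s)) : V g ≤ V f := by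
  simpa using h.add_le le_rfl (f := f) (g := g) (by simpa using hfg)

theorem value_const (h : IsActDependentVariational hX R u C V) (x : X) :
    V (.const A x) = u x := by
  have hint : ∀ p, simpleIntegral ((SimpleMap.const A x).map u) p = u x :=
    simpleIntegral_eq_of_const fun _ => rfl
  refine le_antisymm ?_ ?_
  · obtain ⟨_, ⟨c, hc, rfl⟩, hleast⟩ := (h.value (.const A x)).2.1
    obtain ⟨m, hm⟩ := (h.normalized x).1 c hc
    have hm0 := (h.normalized x).2.2 ⟨c, hc, hm⟩
    obtain ⟨p, rfl⟩ := hm.1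
    have k := hleast.2 ⟨p, rfl⟩
    simp only [hint] at k
    refine EReal.coe_le_coe_iff.1 (k.trans ?_)
    simpa using add_le_add_right hm0 (u x : EReal)
  · obtain ⟨c, hc, hleast⟩ := (h.normalized x).2.1
    obtain ⟨m, hm⟩ := (h.value (.const A x)).1 _ ⟨c, hc, rfl⟩
    have hle := (h.value (.const A x)).2.2 ⟨_, ⟨c, hc, rfl⟩, hm⟩
    obtain ⟨p, rfl⟩ := hm.1
    simp only [hint] at hle
    refine EReal.coe_le_coe_iff.1 (le_trans ?_ hle)
    simpa using add_le_add_right (hleast.2 ⟨p, rfl⟩) (u x : EReal)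

theorem represents_const (h : IsActDependentVariational hX R u C V) (x y : X) :
    R (.const A x) (.const A y) ↔ u y ≤ u x := by
  rw [h.represents, h.value_const, h.value_const]

theorem strictPref_iff (h : IsActDependentVariational hX R u C V) (f g : SimpleMap A X) :
    StrictPref R f g ↔ V g < V f := by
  rw [StrictPref, h.represents, h.represents, not_le]
  exact ⟨fun k => k.2, fun k => ⟨k.le, k⟩⟩

theorem isMBA [Nonempty S] (h : IsActDependentVariational hX R u C V) : IsMBA hX R where
  weakOrder := by
    refine ⟨fun f g => ?_, fun f g k => ?_⟩
    · rw [h.represents, h.represents]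
      exact le_total _ _
    · rw [h.represents, h.represents, h.represents]
      exact fun a b => b.trans a
  riskIndependence := by
    intro x y z α h0 h1
    have h0' : (0 : ℝ) < α := h0
    simp only [Indiff, StrictPref, h.represents_const, h.affine α, add_le_add_iff_right,
      mul_le_mul_iff_right₀ h0']
    exact ⟨id, id⟩
  archimedean := by
    intro f g k hfg hgk
    rw [h.strictPref_iff] at hfg hgk
    obtain ⟨δ, hδ, hf⟩ := h.continuous f (V f - V g) (by linarith)
    obtain ⟨δ', hδ', hk⟩ := h.continuous k (V g - V k) (by linarith)
    -- t is the weight moved from f to k, and t' the weight moved from k to f; each is small enough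
    -- to stay within the continuity radius.
    obtain ⟨t, t0, t1, ht⟩ := SimpleMap.exists_weight_mul_le u k f hδ
    obtain ⟨t', t0', t1', ht'⟩ := SimpleMap.exists_weight_mul_le u f k hδ'
    have r0 : 0 < 1 - t := by linarith
    have r1 : 1 - t < 1 := by linarith
    refine ⟨openWeight (1 - t) r0 r1, openWeight t' t0' t1', openWeight_pos _ r0 r1,
      openWeight_lt_one _ r0 r1, openWeight_pos _ t0' t1', openWeight_lt_one _ t0' t1', ?_, ?_⟩
    · rw [h.strictPref_iff]
      have := hf (mixAct hX (openWeight (1 - t) r0 r1) f k) fun s => by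
        have e : u ((mixAct hX (openWeight (1 - t) r0 r1) f k).toFun s) - u (f.toFun s) =
            t * (u (k.toFun s) - u (f.toFun s)) := by
          rw [h.affine.mixAct]
          simp only [openWeight]
          ring
        rw [e, abs_mul, abs_of_pos t0]
        exact ht s
      linarith [(abs_lt.1 this).1]
    · rw [h.strictPref_iff]
      have := hk (mixAct hX (openWeight t' t0' t1') f k) fun s => by
        have e : u ((mixAct hX (openWeight t' t0' t1') f k).toFun s) - u (k.toFun s) =
            t' * (u (f.toFun s) - u (k.toFun s)) := by
          rw [h.affine.mixAct]
          simp only [openWeight]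
          ring
        rw [e, abs_mul, abs_of_pos t0']
        exact ht' s
      linarith [(abs_lt.1 this).2]
  monotone := by
    intro f g hfg
    rw [h.represents]
    exact h.mono fun s => (h.represents_const _ _).1 (hfg s)

theorem decreasingAbsoluteAmbiguityAversion (h : IsActDependentVariational hX R u C V) :
    DecreasingAbsoluteAmbiguityAversion hX R := by
  intro f x y z α h0 h1 hyx hf
  rw [h.represents_const] at hyx
  have h1' : (0 : ℝ) < 1 - α := sub_pos.2 h1
  have e : ∀ w, V (mixAct hX α (.const A z) (.const A w)) = α * u z + (1 - α) * u w := by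
    intro w
    rw [← h.affine, ← h.value_const]
    rfl
  rw [h.represents, e] at hf ⊢
  -- Passing from x to y raises the constant side by exactly m and the side of f by at least m.
  have k := h.add_le (f := mixAct hX α f (.const A y)) (g := mixAct hX α f (.const A x))
    (m := (1 - α) * (u y - u x)) (mul_nonneg h1'.le (sub_nonneg.2 hyx)) fun s => by
      rw [h.affine.mixAct_const, h.affine.mixAct_const]
      linarith
  linarith

end IsActDependentVariational

/-! ### From the axioms to certainty equivalents. -/

section CertaintyEquivalents

variable {S E : Type*} [AddCommGroup E] [Module ℝ E] {X : Set E} {A : EventAlgebra S}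
  {hX : Convex ℝ X} {R : SimpleMap A X → SimpleMap A X → Prop} {u : X → ℝ}
  {V : SimpleMap A X → ℝ}

theorem IsMBA.isBernoulli (h : IsMBA hX R) :
    IsBernoulli hX fun x y => R (.const A x) (.const A y) where
  total _ _ := h.weakOrder.1 _ _
  trans _ _ _ := h.weakOrder.2 _ _ _
  indep_indiff x y z α h0 h1 := (h.riskIndependence x y z α h0 h1).1
  indep_strict x y z α h0 h1 := (h.riskIndependence x y z α h0 h1).2
  archimedean _ _ _ := h.archimedean _ _ _

theorem IsAffineUtility.exists_eq (hu : IsAffineUtility hX u) {a b : X} {r : ℝ} (ha : u a ≤ r)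
    (hb : r ≤ u b) : ∃ x, u x = r := by
  rcases ha.eq_or_lt with rfl | ha
  · exact ⟨a, rfl⟩
  · have hab : 0 < u b - u a := by linarith
    refine ⟨mix hX ⟨(r - u a) / (u b - u a), div_nonneg (by linarith) hab.le,
      (div_le_one hab).2 (by linarith)⟩ b a, ?_⟩
    rw [hu]
    field_simp
    ring

theorem IsMBA.rel_of_le (h : IsMBA hX R)
    (hR : ∀ x y, R (.const A x) (.const A y) ↔ u y ≤ u x) {f g : SimpleMap A X}
    (hfg : ∀ s, u (g.toFun s) ≤ u (f.toFun s)) : R f g :=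
  h.monotone f g fun s => (hR _ _).2 (hfg s)

/-- Every act has a certainty equivalent. -/
theorem IsMBA.exists_indiff_const [Nonempty S] (h : IsMBA hX R) (hu : IsAffineUtility hX u)
    (hR : ∀ x y, R (.const A x) (.const A y) ↔ u y ≤ u x) (f : SimpleMap A X) :
    ∃ x, Indiff R f (.const A x) := by
  have htr := h.weakOrder.2
  have hst : ∀ f g, ¬ R f g → StrictPref R g f := fun f g hn =>
    ⟨(h.weakOrder.1 f g).resolve_left hn, hn⟩
  obtain ⟨s₀, hs₀⟩ := f.exists_isMinOn u
  obtain ⟨s₁, hs₁⟩ := f.exists_isMinOn fun x => -u x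
  set w := f.toFun s₀
  set z := f.toFun s₁
  have hfw : R f (.const A w) := h.rel_of_le hR hs₀
  have hzf : R (.const A z) f := h.rel_of_le hR fun s => neg_le_neg_iff.1 (hs₁ s)
  let T : Set ℝ := {r | ∃ x, u x = r ∧ R f (.const A x)}
  have hwT : u w ∈ T := ⟨w, rfl, hfw⟩
  have hTb : u z ∈ upperBounds T := by
    rintro _ ⟨x, rfl, hx⟩
    exact (hR _ _).1 (htr _ _ _ hzf hx)
  -- The candidate has utility sup T; affinity of u guarantees that this value is taken. If x ≻ f ≻
  -- w, some mixture of x and w, of utility below sup T, is still better than f; if z ≻ f ≻ x, some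
  -- mixture of z and x lies in T above its supremum.
  obtain ⟨x, hx⟩ := hu.exists_eq (le_csSup ⟨_, hTb⟩ hwT) (csSup_le ⟨_, hwT⟩ hTb)
  refine ⟨x, ?_, ?_⟩
  · by_contra hn
    by_cases hwf : R (.const A w) f
    · refine hn (htr _ _ _ hfw ((hR _ _).2 ?_))
      rw [hx]
      refine csSup_le ⟨_, hwT⟩ ?_
      rintro _ ⟨y, rfl, hy⟩
      exact (hR _ _).1 (htr _ _ _ hwf hy)
    · obtain ⟨α, -, α0, α1, -, -, hα, -⟩ := h.archimedean _ _ _ (hst _ _ hn) (hst _ _ hwf)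
      have hwx : u w < u x := by
        by_contra hle
        exact hn (htr _ _ _ hfw ((hR _ _).2 (not_lt.1 hle)))
      have hlt : u (mix hX α x w) < sSup T := by
        rw [← hx, hu]
        have : (0 : ℝ) < 1 - α := sub_pos.2 α1
        nlinarith
      obtain ⟨_, ⟨y, rfl, hy⟩, hlt⟩ := exists_lt_of_lt_csSup ⟨_, hwT⟩ hlt
      exact hα.2 (htr _ _ _ hy ((hR _ _).2 hlt.le))
  · by_contra hn
    have hzx : u x < u z := by
      by_contra hle
      exact hn (htr _ _ _ ((hR _ _).2 (not_lt.1 hle)) hzf)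
    by_cases hfz : R f (.const A z)
    · have := le_csSup ⟨_, hTb⟩ (show u z ∈ T from ⟨z, rfl, hfz⟩)
      linarith
    · obtain ⟨-, β, -, -, β0, -, -, hβ⟩ := h.archimedean _ _ _ (hst _ _ hfz) (hst _ _ hn)
      have := le_csSup ⟨_, hTb⟩ (show u (mix hX β z x) ∈ T from ⟨_, rfl, hβ.1⟩)
      rw [← hx, hu] at this
      have : (0 : ℝ) < β := β0
      nlinarith

/-- `V` assigns to each act the utility of a certainty equivalent, monotonically in utility. -/
structure IsMonotoneEvaluation (hX : Convex ℝ X) (u : X → ℝ) (V : SimpleMap A X → ℝ) : Prop where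
  affine : IsAffineUtility hX u
  const : ∀ x, V (.const A x) = u x
  attained : ∀ f, ∃ x, u x = V f
  mono : ∀ f g : SimpleMap A X, (∀ s, u (g.toFun s) ≤ u (f.toFun s)) → V g ≤ V f

/-! ### Continuity and superadditivity of the evaluation. -/

namespace IsMonotoneEvaluation

/-- This symmetry turns upper semicontinuity into lower semicontinuity. -/
theorem neg (h : IsMonotoneEvaluation hX u V) :
    IsMonotoneEvaluation hX (fun x => -u x) fun f => -V f where
  affine α x y := by
    simp only [h.affine α]
    ring
  const x := by rw [h.const]
  attained f := (h.attained f).imp fun x hx => by rw [hx]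
  mono f g hfg := neg_le_neg (h.mono g f fun s => neg_le_neg_iff.1 (hfg s))

theorem congr (h : IsMonotoneEvaluation hX u V) {f g : SimpleMap A X}
    (hfg : ∀ s, u (f.toFun s) = u (g.toFun s)) : V f = V g :=
  le_antisymm (h.mono _ _ fun s => (hfg s).le) (h.mono _ _ fun s => (hfg s).ge)

theorem le_of_forall_le (h : IsMonotoneEvaluation hX u V) {f : SimpleMap A X} {x : X}
    (hf : ∀ s, u (f.toFun s) ≤ u x) : V f ≤ u x :=
  h.const x ▸ h.mono (.const A x) f hf

theorem ge_of_forall_ge (h : IsMonotoneEvaluation hX u V) {f : SimpleMap A X} {x : X}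
    (hf : ∀ s, u x ≤ u (f.toFun s)) : u x ≤ V f :=
  h.const x ▸ h.mono f (.const A x) hf

/-- Archimedean evaluations are upper semicontinuous for the supremum norm. -/
theorem exists_lt_of_archimedean [Nonempty S] (h : IsMonotoneEvaluation hX u V)
    (ha : ∀ f g k, V g < V f → V k < V g → ∃ β : unitInterval, 0 < β ∧
      V (mixAct hX β f k) < V g) (f : SimpleMap A X) {t : ℝ} (ht : V f < t) :
    ∃ δ > 0, ∀ g : SimpleMap A X, (∀ s, u (g.toFun s) ≤ u (f.toFun s) + δ) → V g < t := by
  by_cases htop : ∀ x, u x ≤ V f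
  · refine ⟨1, one_pos, fun g _ => ?_⟩
    obtain ⟨x, hx⟩ := h.attained g
    linarith [htop x]
  push Not at htop
  obtain ⟨z', hz'⟩ := htop
  obtain ⟨s₁, hs₁⟩ := f.exists_isMinOn fun x => -u x
  replace hs₁ : ∀ s, u (f.toFun s) ≤ u (f.toFun s₁) := fun s => neg_le_neg_iff.1 (hs₁ s)
  -- Either z lies strictly above f in every state, or it is a best consequence, so that no g can
  -- exceed u(z) where f already reaches it.
  obtain ⟨z, hzV, hz⟩ : ∃ z, V f < u z ∧ ∀ s x, u z ≤ u (f.toFun s) → u x ≤ u z := by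
    by_cases hex : ∃ z, ∀ s, u (f.toFun s) < u z
    · obtain ⟨z, hz⟩ := hex
      exact ⟨z, (h.le_of_forall_le hs₁).trans_lt (hz s₁), fun s x hs => absurd (hz s) hs.not_gt⟩
    · push Not at hex
      have hmax : ∀ x, u x ≤ u (f.toFun s₁) := fun x => by
        obtain ⟨s, hs⟩ := hex x
        exact hs.trans (hs₁ s)
      exact ⟨f.toFun s₁, hz'.trans_le (hmax z'), fun s x _ => hmax x⟩
  obtain ⟨r, hr, hrt⟩ := exists_between (lt_min ht hzV)
  obtain ⟨x, hx⟩ := h.attained f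
  obtain ⟨w, rfl⟩ := h.affine.exists_eq (a := x) (b := z) (r := r) (by linarith)
    (hrt.le.trans (min_le_right _ _))
  obtain ⟨β, β0, hβ⟩ := ha (.const A z) (.const A w) f
    (by rw [h.const, h.const]; exact hrt.trans_le (min_le_right _ _)) (by rwa [h.const])
  rw [h.const] at hβ
  -- The gap from f up to z where there is one; elsewhere any positive value would do. With δ equal
  -- to β times the least gap, g is dominated by βz + (1 - β)f.
  let η : X → ℝ := fun y => if u y < u z then u z - u y else 1
  have hη : ∀ y, 0 < η y := by
    intro y
    simp only [η]
    split_ifs with hy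
    · linarith
    · exact one_pos
  obtain ⟨s₀, hs₀⟩ := f.exists_isMinOn η
  have β0' : (0 : ℝ) < β := β0
  refine ⟨β * η (f.toFun s₀), mul_pos β0' (hη _), fun g hg => ?_⟩
  refine lt_of_le_of_lt (h.mono (mixAct hX β (.const A z) f) g fun s => ?_)
    (hβ.trans (hrt.trans_le (min_le_left _ _)))
  rw [h.affine.mixAct]
  simp only [SimpleMap.const]
  by_cases hs : u (f.toFun s) < u z
  · have k := hs₀ s
    have e : η (f.toFun s) = u z - u (f.toFun s) := if_pos hs
    rw [e] at k
    nlinarith [hg s, mul_le_mul_of_nonneg_left k β0'.le]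
  · have k1 := hz s (g.toFun s) (not_lt.1 hs)
    have k2 : (0 : ℝ) ≤ 1 - β := sub_nonneg.2 β.2.2
    nlinarith

theorem supNormContinuous [Nonempty S] (h : IsMonotoneEvaluation hX u V)
    (hR : ∀ f g, R f g ↔ V g ≤ V f) (ha : ArchimedeanContinuity hX R) :
    SupNormContinuous u V := by
  have hst : ∀ f g, StrictPref R f g ↔ V g < V f := fun f g => by
    rw [StrictPref, hR, hR, not_le]
    exact ⟨fun k => k.2, fun k => ⟨k.le, k⟩⟩
  intro f ε hε
  obtain ⟨δ, hδ, k⟩ := h.exists_lt_of_archimedean (fun f g k hfg hgk => by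
    obtain ⟨-, β, -, -, β0, -, -, hβ⟩ := ha f g k ((hst _ _).2 hfg) ((hst _ _).2 hgk)
    exact ⟨β, β0, (hst _ _).1 hβ⟩) f (lt_add_of_pos_right (V f) hε)
  obtain ⟨δ', hδ', k'⟩ := h.neg.exists_lt_of_archimedean (fun f g k hfg hgk => by
    obtain ⟨α, -, α0, α1, -, -, hα, -⟩ := ha k g f ((hst _ _).2 (neg_lt_neg_iff.1 hgk))
      ((hst _ _).2 (neg_lt_neg_iff.1 hfg))
    refine ⟨unitInterval.symm α, sub_pos.2 (show (α : ℝ) < 1 from α1), ?_⟩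
    have e : V (mixAct hX (unitInterval.symm α) f k) = V (mixAct hX α k f) := h.congr fun s => by
      rw [h.affine.mixAct, h.affine.mixAct, unitInterval.coe_symm_eq]
      ring
    rw [e]
    exact neg_lt_neg ((hst _ _).1 hα)) f (lt_add_of_pos_right (-V f) hε)
  refine ⟨min δ δ', lt_min hδ hδ', fun g hg => abs_lt.2 ⟨?_, ?_⟩⟩
  · have := k' g fun s => by
      linarith [(abs_le.1 ((hg s).trans (min_le_right _ _))).1]
    linarith
  · have := k g fun s => by
      linarith [(abs_le.1 ((hg s).trans (min_le_left _ _))).2]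
    linarith

/-- Decreasing absolute ambiguity aversion makes the evaluation superadditive with respect to
nonnegative constants. -/
theorem add_le [Nonempty S] (h : IsMonotoneEvaluation hX u V) (hR : ∀ f g, R f g ↔ V g ≤ V f)
    (hD : DecreasingAbsoluteAmbiguityAversion hX R) {f g : SimpleMap A X} {m : ℝ} (hm : 0 ≤ m)
    (hfg : ∀ s, u (g.toFun s) + m ≤ u (f.toFun s)) : V g + m ≤ V f := by
  rcases hm.eq_or_lt with rfl | hm
  · simpa using h.mono f g (by simpa using hfg)
  obtain ⟨s₀, hs₀⟩ := g.exists_isMinOn u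
  obtain ⟨s₁, hs₁⟩ := g.exists_isMinOn fun x => -u x
  replace hs₁ : ∀ s, u (g.toFun s) ≤ u (g.toFun s₁) := fun s => neg_le_neg_iff.1 (hs₁ s)
  set x := g.toFun s₀
  set b := g.toFun s₁
  have hxb : u x ≤ u b := hs₁ s₀
  obtain ⟨y, hy⟩ := h.affine.exists_eq (a := b) (r := u b + m) (by linarith) (hfg s₁)
  have hVx := h.ge_of_forall_ge hs₀
  have hVb := h.le_of_forall_le hs₁
  -- If g is constant in utility, the weight α below would be 0, so this case is separate.
  rcases hxb.eq_or_lt with he | hlt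
  · have : u y ≤ V f := h.ge_of_forall_ge fun s => by
      linarith [hfg s, hs₀ s]
    linarith
  · have hd : 0 < u b - u x + m := by linarith
    -- This weight shrinks [u(x), u(y)] towards u(x) exactly onto [u(x), u(b)], so that g is in
    -- utility αθ(g) + (1 - α)x; moreover (1 - α)(u(y) - u(x)) = m.
    have a0 : 0 < (u b - u x) / (u b - u x + m) := div_pos (by linarith) hd
    have a1 : (u b - u x) / (u b - u x + m) < 1 := (div_lt_one hd).2 (by linarith)
    set α := openWeight _ a0 a1
    have hα : (α : ℝ) * (u b - u x + m) = u b - u x := div_mul_cancel₀ _ hd.ne'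
    have a0' : (0 : ℝ) < α := a0
    have hex : ∀ r, u x ≤ r → r ≤ u b → ∃ v, (α : ℝ) * u v + (1 - α) * u x = r := by
      intro r hr hrb
      obtain ⟨v, hv⟩ := h.affine.exists_eq (a := x) (b := y) (r := u x + (r - u x) / α)
        (le_add_of_nonneg_right (div_nonneg (by linarith) a0'.le)) (by
          have : (r - u x) / α ≤ u b - u x + m := by
            rw [div_le_iff₀ a0']
            linarith
          linarith)
      refine ⟨v, ?_⟩
      rw [hv]
      field_simp
      ring
    obtain ⟨z, hz⟩ := hex (V g) hVx hVb
    choose! θ hθ using fun v : X => fun hv : u x ≤ u v ∧ u v ≤ u b => hex (u v) hv.1 hv.2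
    have e1 : V (mixAct hX α (g.map θ) (.const A x)) = V g := h.congr fun s => by
      rw [h.affine.mixAct_const]
      exact hθ _ ⟨hs₀ s, hs₁ s⟩
    have e2 : ∀ w, V (mixAct hX α (.const A z) (.const A w)) = α * u z + (1 - α) * u w := by
      intro w
      rw [← h.affine, ← h.const]
      rfl
    have k := hD (g.map θ) x y z α (openWeight_pos _ a0 a1) (openWeight_lt_one _ a0 a1)
      (by rw [hR, h.const, h.const]; linarith) (by rw [hR, e1, e2, hz])
    rw [hR, e2] at k
    have k2 := h.mono f (mixAct hX α (g.map θ) (.const A y)) fun s => by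
      rw [h.affine.mixAct_const]
      have := hθ _ ⟨hs₀ s, hs₁ s⟩
      have e3 : (g.map θ).toFun s = θ (g.toFun s) := rfl
      rw [e3]
      have := hfg s
      nlinarith
    nlinarith

/-! ### Supporting costs and the max-min formula. -/

/-- The costs of an act: those supporting the evaluation at a dominated act. -/
def supportingCosts {Y : Type*} (u : Y → ℝ) (V : SimpleMap A Y → ℝ) (f : SimpleMap A Y) :
    Set (FinAddProb A → EReal) :=
  {c | ∃ g : SimpleMap A Y, (∀ s, u (g.toFun s) ≤ u (f.toFun s)) ∧
    c = fun p => ((V g - simpleIntegral (g.map u) p : ℝ) : EReal)}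

theorem isAmbiguityCost_supporting (v : ℝ) (φ : SimpleMap A ℝ) :
    IsAmbiguityCost fun p : FinAddProb A => ((v - simpleIntegral φ p : ℝ) : EReal) where
  ne_bot _ := EReal.coe_ne_bot _
  lowerSemicontinuous := (continuous_coe_real_ereal.comp
    (continuous_const.sub (continuous_simpleIntegral φ))).lowerSemicontinuous
  convex p q r a b _ _ hab hr := by
    rw [← EReal.coe_mul, ← EReal.coe_mul, ← EReal.coe_add, EReal.coe_le_coe_iff,
      simpleIntegral_convexCombination φ hr]
    have : v = a * v + b * v := by rw [← add_mul, hab, one_mul]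
    linarith

/-- The cost of g contributes V(g) + m, where m ≥ 0 is the least value of u(f) - u(g); `hadd` bounds
this by V(f), and g = f attains the bound. -/
theorem isMaxMin_supportingCosts {S Y : Type*} [Nonempty S] {A : EventAlgebra S}
    {u : Y → ℝ} {V : SimpleMap A Y → ℝ}
    (hadd : ∀ (f g : SimpleMap A Y) (m : ℝ), 0 ≤ m →
      (∀ s, u (g.toFun s) + m ≤ u (f.toFun s)) → V g + m ≤ V f) (f : SimpleMap A Y) :
    IsMaxMin ((fun c p => ((simpleIntegral (f.map u) p : ℝ) : EReal) + c p) ''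
      supportingCosts u V f) (V f : EReal) := by
  refine ⟨?_, ⟨_, ⟨_, ⟨f, fun s => le_rfl, rfl⟩, rfl⟩, ?_⟩, ?_⟩
  · rintro _ ⟨_, ⟨g, hg, rfl⟩, rfl⟩
    obtain ⟨m, -, -, hl⟩ := exists_isLeast_simpleIntegral_sub (f.map u) (g.map u) (V g)
    exact ⟨_, by simpa only [EReal.coe_add] using hl⟩
  · obtain ⟨m, ⟨s, hs⟩, -, hl⟩ := exists_isLeast_simpleIntegral_sub (f.map u) (f.map u) (V f)
    have hm : m = 0 := by linarith
    subst hm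
    simpa only [EReal.coe_add, add_zero] using hl
  · rintro v ⟨_, ⟨_, ⟨g, hg, rfl⟩, rfl⟩, hv⟩
    obtain ⟨m, ⟨s, hs⟩, hm, hl⟩ := exists_isLeast_simpleIntegral_sub (f.map u) (g.map u) (V g)
    simp only [EReal.coe_add] at hl
    rw [hv.unique hl, ← EReal.coe_add, EReal.coe_le_coe_iff]
    have hs' : u (f.toFun s) = u (g.toFun s) + m := hs
    exact hadd f g m (by linarith [hg s]) hm

/-- The minimum of the cost of g is V(g) - max u(g), which is nonpositive by monotonicity and zero
when g is constant. -/
theorem isMaxMin_supportingCosts_const [Nonempty S] (h : IsMonotoneEvaluation hX u V) (x : X) :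
    IsMaxMin (supportingCosts u V (.const A x)) 0 := by
  have hl : ∀ g : SimpleMap A X, ∃ m, (∃ s, 0 = u (g.toFun s) + m) ∧
      (∀ s, u (g.toFun s) + m ≤ 0) ∧ IsLeast (Set.range fun p : FinAddProb A =>
        ((V g - simpleIntegral (g.map u) p : ℝ) : EReal)) ((V g + m : ℝ) : EReal) := by
    intro g
    have k := exists_isLeast_simpleIntegral_sub (SimpleMap.const A (0 : ℝ)) (g.map u) (V g)
    have h0 : ∀ p, simpleIntegral (SimpleMap.const A (0 : ℝ)) p = 0 :=
      simpleIntegral_eq_of_const fun _ => rfl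
    simp only [h0, zero_add] at k
    exact k
  refine ⟨?_, ⟨_, ⟨.const A x, fun s => le_rfl, rfl⟩, ?_⟩, ?_⟩
  · rintro _ ⟨g, -, rfl⟩
    obtain ⟨m, -, -, hm⟩ := hl g
    exact ⟨_, hm⟩
  · obtain ⟨m, ⟨s, hs⟩, -, hm⟩ := hl (.const A x)
    have e : V (.const A x) + m = 0 := by
      rw [h.const]
      exact hs.symm
    rwa [e] at hm
  · rintro v ⟨_, ⟨g, -, rfl⟩, hv⟩
    obtain ⟨m, ⟨s, hs⟩, hm, hlm⟩ := hl g
    rw [hv.unique hlm, ← EReal.coe_zero, EReal.coe_le_coe_iff]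
    have := h.le_of_forall_le (f := g) (x := g.toFun s) fun s' => by linarith [hm s']
    linarith

end IsMonotoneEvaluation

end CertaintyEquivalents

theorem proposition1 {S : Type*} [Nonempty S] (A : EventAlgebra S)
    {E : Type*} [AddCommGroup E] [Module ℝ E] (X : Set E) (hX : Convex ℝ X) (hXne : X.Nonempty)
    (R : SimpleMap A X → SimpleMap A X → Prop) :
    (IsMBA hX R ∧ DecreasingAbsoluteAmbiguityAversion hX R) ↔
      ∃ (u : X → ℝ) (C : SimpleMap A X → Set (FinAddProb A → EReal)) (V : SimpleMap A X → ℝ),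
        IsActDependentVariational hX R u C V := by
  constructor
  · rintro ⟨hM, hD⟩
    obtain ⟨u, hu, hconst⟩ := hM.isBernoulli.exists_affine hXne
    choose ce hce using hM.exists_indiff_const hu hconst
    have htr := hM.weakOrder.2
    have hR : ∀ f g, R f g ↔ u (ce g) ≤ u (ce f) := fun f g => by
      rw [← hconst]
      exact ⟨fun k => htr _ _ _ (hce f).2 (htr _ _ _ k (hce g).1),
        fun k => htr _ _ _ (hce f).1 (htr _ _ _ k (hce g).2)⟩
    have hV : IsMonotoneEvaluation hX u fun f => u (ce f) := {
      affine := hu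
      const := fun x => le_antisymm ((hconst _ _).1 (hce (.const A x)).1)
        ((hconst _ _).1 (hce (.const A x)).2)
      attained := fun f => ⟨ce f, rfl⟩
      mono := fun f g hfg => (hR f g).1 (hM.rel_of_le hconst hfg) }
    exact ⟨u, IsMonotoneEvaluation.supportingCosts u fun f => u (ce f), fun f => u (ce f), {
      affine := hu
      cost := by
        rintro f _ ⟨g, -, rfl⟩
        exact IsMonotoneEvaluation.isAmbiguityCost_supporting _ _
      value := IsMonotoneEvaluation.isMaxMin_supportingCosts fun f g m hm hfg => hV.add_le hR hD hm hfg
      represents := hR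
      normalized := hV.isMaxMin_supportingCosts_const
      enlarging := by
        rintro f g hfg _ ⟨k, hk, rfl⟩
        exact ⟨k, fun s => (hk s).trans (hfg s), rfl⟩
      continuous := hV.supNormContinuous hR hM.archimedean }⟩
  · rintro ⟨u, C, V, h⟩
    exact ⟨h.isMBA, h.decreasingAbsoluteAmbiguityAversion⟩
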